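/- Let $n\ge 2$ and $K>0$, let $(M,g)$ be a complete smooth $n$-dimensional Riemannian manifold with $\mathrm{Ric}\ge (n-1)K\,g$, and let $\Omega\subset M$ be a bounded domain (a bounded, connected, non-empty open set) with $C^1$ boundary. Let $dv$ be the Riemannian volume. Let $H^1(\Omega)$ and $H^2(\Omega)$ be the completions of the smooth functions on $\Omega$ of finite norm for the norms $\big(\int_\Omega |\nabla f|^2+f^2\,dv\big)^{1/2}$ and $\big(\int_\Omega |D^2f|^2+|\nabla f|^2+f^2\,dv\big)^{1/2}$, and let $\mathcal H^1(\Omega)$ be the completion of the smooth $1$-forms on $\Omega$ of finite norm for the norm $\big(\int_\Omega |\nabla\omega|^2+|\omega|^2\,dv\big)^{1/2}$, where $\nabla$ is the Levi-Civita connection. For $j\in\{1,2,\dots\}$ let $$\mu_j=\min_{\substack{U\subset H^2(\Omega)\\ \dim U=j}}\ \max_{0\neq u\in U}\frac{\int_\Omega |D^2u|^2+\mathrm{Ric}(\nabla u,\nabla u)\,dv}{\int_\Omega u^2\,dv},\qquad m_j=\min_{\substack{U\subset H^1(\Omega)\\ \dim U=j}}\ \max_{0\neq u\in U}\frac{\int_\Omega|\nabla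 u|^2\,dv}{\int_\Omega u^2\,dv}$$ be the $j$-th Neumann eigenvalues on $\Omega$ of the biharmonic operator and of the Laplacian, and let $$\eta_1=\min_{0\neq\omega\in\mathcal H^1(\Omega)}\frac{\int_\Omega|\nabla\omega|^2\,dv}{\int_\Omega|\omega|^2\,dv}$$ be the first Neumann eigenvalue of the rough Laplacian on $1$-forms of $\Omega$. Then, for all $j\ge 1$, $$\mu_j\ \ge\ \big(\eta_1+(n-1)K\big)\,m_j .$$ -/

import Mathlib

open scoped Manifold ContDiff Topology Bundle
open MeasureTheory Bundle

noncomputable section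

namespace NeumannBiharmonic

/-- The model space of an `n`-dimensional manifold. -/
abbrev Model (n : ℕ) : Type := EuclideanSpace ℝ (Fin n)

/-- The `i`-th partial derivative of a function on the model space. -/
def partialDeriv {n : ℕ} (i : Fin n) (F : Model n → ℝ) (y : Model n) : ℝ :=
  fderiv ℝ F y (EuclideanSpace.single i 1)

section Geometry

variable {n : ℕ} {M : Type*} [MetricSpace M] [ChartedSpace (Model n) M]

/-- A covector at `x`. -/
abbrev Covector (n : ℕ) {M : Type*} [MetricSpace M] [ChartedSpace (Model n) M] (x : M) : Type :=
  TangentSpace (𝓡 n) x →L[ℝ] ℝ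

/-- A covariant `2`-tensor at `x`. -/
abbrev TwoTensor (n : ℕ) {M : Type*} [MetricSpace M] [ChartedSpace (Model n) M] (x : M) : Type :=
  TangentSpace (𝓡 n) x →L[ℝ] TangentSpace (𝓡 n) x →L[ℝ] ℝ

instance (x : M) : AddCommGroup (Covector n x) := ContinuousLinearMap.addCommGroup

instance (x : M) : Module ℝ (Covector n x) := ContinuousLinearMap.module

instance (x : M) : AddCommGroup (TwoTensor n x) := ContinuousLinearMap.addCommGroup

instance (x : M) : Module ℝ (TwoTensor n x) := ContinuousLinearMap.module

/-- The coordinate vector `∂/∂yᵢ` of the preferred chart at `p`, at the point with coordinates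
`y` in that chart. -/
def coordVec (p : M) (y : Model n) (i : Fin n) :
    TangentSpace (𝓡 n) ((extChartAt (𝓡 n) p).symm y) :=
  mfderiv 𝓘(ℝ, Model n) (𝓡 n) (extChartAt (𝓡 n) p).symm y (EuclideanSpace.single i (1 : ℝ))

/-- The coordinate covector `dyᵢ` at `x` of the preferred chart at `x`. -/
def coordCovec (x : M) (i : Fin n) : Covector n x :=
  (EuclideanSpace.proj i : Model n →L[ℝ] ℝ).comp
    (mfderiv (𝓡 n) 𝓘(ℝ, Model n) (extChartAt (𝓡 n) x) x)

/-- The components `θⱼ` of a `1`-form in the preferred chart at `p`. -/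
def formCoeff (θ : ∀ x : M, Covector n x) (p : M) (j : Fin n) (y : Model n) : ℝ :=
  θ ((extChartAt (𝓡 n) p).symm y) (coordVec p y j)

/-- The differential of a function, as a `1`-form. -/
def differential (f : M → ℝ) (x : M) : Covector n x :=
  mfderiv (𝓡 n) 𝓘(ℝ, ℝ) f x

variable [RiemannianBundle (fun x : M ↦ TangentSpace (𝓡 n) x)]

/-- The matrix `gᵢⱼ` of the metric in the preferred chart at `p`. -/
def metricCoeff (p : M) (y : Model n) : Matrix (Fin n) (Fin n) ℝ :=
  Matrix.of fun i j ↦ inner ℝ (coordVec p y i) (coordVec p y j)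

/-- The Christoffel symbols `Γᵏᵢⱼ` of the Levi-Civita connection in the preferred chart at `p`:
`Γᵏᵢⱼ = ½ ∑ₗ gᵏˡ (∂ᵢ gⱼₗ + ∂ⱼ gᵢₗ - ∂ₗ gᵢⱼ)`. -/
def christoffel (p : M) (k i j : Fin n) (y : Model n) : ℝ :=
  (1 / 2) * ∑ l, (metricCoeff p y)⁻¹ k l *
    (partialDeriv i (fun z ↦ metricCoeff p z j l) y
      + partialDeriv j (fun z ↦ metricCoeff p z i l) y
      - partialDeriv l (fun z ↦ metricCoeff p z i j) y)

/-- The components of the Ricci tensor in the preferred chart at `p`: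
`Ricᵢⱼ = ∂ₖ Γᵏᵢⱼ - ∂ⱼ Γᵏᵢₖ + Γᵏₖₗ Γˡᵢⱼ - Γᵏⱼₗ Γˡᵢₖ`. -/
def ricciCoeff (p : M) (y : Model n) (i j : Fin n) : ℝ :=
  ∑ k, (partialDeriv k (christoffel p k i j) y - partialDeriv j (christoffel p k i k) y)
    + ∑ k, ∑ l, (christoffel p k k l y * christoffel p l i j y
        - christoffel p k j l y * christoffel p l i k y)

/-- The Ricci tensor. -/
def ricci (x : M) : TwoTensor n x :=
  ∑ i, ∑ j, ricciCoeff x (extChartAt (𝓡 n) x x) i j •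
    (coordCovec x i).smulRight (coordCovec x j)

/-- The covariant derivative of a `1`-form for the Levi-Civita connection:
`(∇θ)ᵢⱼ = ∂ᵢ θⱼ - Γᵏᵢⱼ θₖ`. -/
def covDeriv (θ : ∀ x : M, Covector n x) (x : M) : TwoTensor n x :=
  ∑ i, ∑ j, (partialDeriv i (formCoeff θ x j) (extChartAt (𝓡 n) x x)
      - ∑ k, christoffel x k i j (extChartAt (𝓡 n) x x)
          * formCoeff θ x k (extChartAt (𝓡 n) x x)) •
    (coordCovec x i).smulRight (coordCovec x j)

/-- The Hessian `D²f = ∇ df`. -/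
def hessian (f : M → ℝ) (x : M) : TwoTensor n x :=
  covDeriv (differential f) x

instance (x : M) : FiniteDimensional ℝ (TangentSpace (𝓡 n) x) :=
  inferInstanceAs (FiniteDimensional ℝ (Model n))

/-- The vector `α♯` metrically dual to a covector `α`; thus `∇f = (df)♯`. -/
def sharp {x : M} (α : Covector n x) : TangentSpace (𝓡 n) x :=
  ∑ a, α (stdOrthonormalBasis ℝ (TangentSpace (𝓡 n) x) a) •
    stdOrthonormalBasis ℝ (TangentSpace (𝓡 n) x) a

/-- The squared norm `|α|²` of a covector. -/
def covectorNormSq {x : M} (α : Covector n x) : ℝ :=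
  ∑ a, (α (stdOrthonormalBasis ℝ (TangentSpace (𝓡 n) x) a)) ^ 2

/-- The squared (Hilbert-Schmidt) norm `|A|²` of a covariant `2`-tensor. -/
def tensorNormSq {x : M} (A : TwoTensor n x) : ℝ :=
  ∑ a, ∑ b, (A (stdOrthonormalBasis ℝ (TangentSpace (𝓡 n) x) a)
    (stdOrthonormalBasis ℝ (TangentSpace (𝓡 n) x) b)) ^ 2

/-- A `1`-form is smooth on `Ω`. -/
def SmoothFormOn [IsManifold (𝓡 n) ∞ M] (θ : ∀ x : M, Covector n x) (Ω : Set M) : Prop :=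
  ContMDiffOn (𝓡 n) ((𝓡 n).prod 𝓘(ℝ, Model n →L[ℝ] ℝ)) ∞
    (fun x ↦ Bundle.TotalSpace.mk' (Model n →L[ℝ] ℝ)
      (E := fun x : M ↦ TangentSpace (𝓡 n) x →L[ℝ] Bundle.Trivial M ℝ x) x (θ x)) Ω

variable [MeasurableSpace M]

/-- The measure `√(det gᵢⱼ) dy` on the domain of the preferred chart at `p`. -/
def chartVolume (n : ℕ) {M : Type*} [MetricSpace M] [ChartedSpace (Model n) M]
    [RiemannianBundle (fun x : M ↦ TangentSpace (𝓡 n) x)] [MeasurableSpace M] (p : M) :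
    Measure M :=
  (((volume : Measure (Model n)).restrict (extChartAt (𝓡 n) p).target).withDensity
    fun y ↦ ENNReal.ofReal (Real.sqrt (metricCoeff p y).det)).map (extChartAt (𝓡 n) p).symm

/-- The Riemannian volume measure `dv`: the least measure that dominates `√(det gᵢⱼ) dy` on the
domain of each preferred chart. The chart measures agree on overlaps and countably many charts
cover `M`, so that `dv` restricts to `√(det gᵢⱼ) dy` on every chart domain. -/
def riemannianVolume (n : ℕ) {M : Type*} [MetricSpace M] [ChartedSpace (Model n) M]
    [RiemannianBundle (fun x : M ↦ TangentSpace (𝓡 n) x)] [MeasurableSpace M] : Measure M :=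
  ⨆ p : M, chartVolume n p

end Geometry

/-- `Ω` has `C¹` boundary: near each boundary point, `Ω` is the sublevel set of a `C¹` function
with non-vanishing differential. -/
def HasC1Boundary (n : ℕ) {M : Type*} [MetricSpace M] [ChartedSpace (Model n) M]
    (Ω : Set M) : Prop :=
  ∀ p ∈ frontier Ω, ∃ (V : Set M) (ρ : M → ℝ), IsOpen V ∧ p ∈ V ∧
    ContMDiffOn (𝓡 n) 𝓘(ℝ, ℝ) 1 ρ V ∧
    (∀ q ∈ V, (differential ρ q : Covector n q) ≠ 0) ∧
    Ω ∩ V = {q ∈ V | ρ q < 0}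

/-- Strong `L²(μ)`-convergence `s k → t` of square-integrable fields, where `nsq s` is the
pointwise squared norm of the field `s`. -/
def L2Converges {M S : Type*} [MeasurableSpace M] [AddCommGroup S] (μ : Measure M)
    (nsq : S → M → ℝ) (s : ℕ → S) (t : S) : Prop :=
  (∀ k, Integrable (nsq (s k)) μ) ∧ Integrable (nsq t) μ ∧
    (∀ k, Integrable (nsq (s k - t)) μ) ∧
    Filter.Tendsto (fun k ↦ ∫ x, nsq (s k - t) x ∂μ) Filter.atTop (𝓝 0)

/-- The min-max value
`inf_{U ⊆ D, dim U = j} sup_{0 ≠ u ∈ U} (∫ num u dμ) / (∫ den u dμ)`.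
of the quadratic forms `∫ num u dμ` and `∫ den u dμ`, as an extended real number (so that no
boundedness or non-emptiness is needed to make sense of it). Elements of `D` with `∫ den u = 0`
represent the zero function; the condition on `U` says that `U` has dimension `j` modulo such
elements. -/
def minMax {M V : Type*} [MeasurableSpace M] [AddCommGroup V] [Module ℝ V] (μ : Measure M)
    (D : Set V) (num den : V → M → ℝ) (j : ℕ) : EReal :=
  ⨅ U : {U : Submodule ℝ V // Module.finrank ℝ U = j ∧
      ∀ u ∈ U, u ∈ D ∧ Integrable (num u) μ ∧ (u ≠ 0 → 0 < ∫ x, den u x ∂μ)},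
    ⨆ u : {u : V // u ∈ U.1 ∧ u ≠ 0}, (((∫ x, num u.1 x ∂μ) / (∫ x, den u.1 x ∂μ) : ℝ) : EReal)

section Spaces

variable (n : ℕ) {M : Type*} [MetricSpace M] [ChartedSpace (Model n) M]
  [RiemannianBundle (fun x : M ↦ TangentSpace (𝓡 n) x)] [MeasurableSpace M]

/-- The Riemannian volume measure of `Ω`. -/
def volumeOn (Ω : Set M) : Measure M := (riemannianVolume n).restrict Ω

/-- Pointwise square of a function. -/
def funSq (u : M → ℝ) (x : M) : ℝ := u x ^ 2

/-- Pointwise squared norm of a `1`-form. -/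
def formSq (θ : ∀ x : M, Covector n x) (x : M) : ℝ := covectorNormSq (θ x)

/-- Pointwise squared norm of a covariant `2`-tensor field. -/
def tensorSq (A : ∀ x : M, TwoTensor n x) (x : M) : ℝ := tensorNormSq (A x)

/-- `H¹(Ω)`, the completion of `C^∞(Ω)` for the norm `(∫ |∇f|² + f²)^{1/2}`, realized as the
closure of the pairs `(f, df)` in `L²`: its elements are the functions `u` together with their
differential `du`. -/
def sobolevH1 (Ω : Set M) : Set ((M → ℝ) × (∀ x : M, Covector n x)) :=
  {p | ∃ f : ℕ → M → ℝ, (∀ k, ContMDiffOn (𝓡 n) 𝓘(ℝ, ℝ) ∞ (f k) Ω) ∧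
    L2Converges (volumeOn n Ω) funSq f p.1 ∧
    L2Converges (volumeOn n Ω) (formSq n) (fun k ↦ differential (f k)) p.2}

/-- `H²(Ω)`, the completion of `C^∞(Ω)` for the norm `(∫ |D²f|² + |∇f|² + f²)^{1/2}`, realized
as the closure of the triples `(f, df, D²f)` in `L²`: its elements are the functions `u` together
with `du` and `D²u`. -/
def sobolevH2 (Ω : Set M) :
    Set ((M → ℝ) × (∀ x : M, Covector n x) × (∀ x : M, TwoTensor n x)) :=
  {p | ∃ f : ℕ → M → ℝ, (∀ k, ContMDiffOn (𝓡 n) 𝓘(ℝ, ℝ) ∞ (f k) Ω) ∧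
    L2Converges (volumeOn n Ω) funSq f p.1 ∧
    L2Converges (volumeOn n Ω) (formSq n) (fun k ↦ differential (f k)) p.2.1 ∧
    L2Converges (volumeOn n Ω) (tensorSq n) (fun k ↦ hessian (f k)) p.2.2}

/-- The space of `1`-forms of class `H¹(Ω)`: the completion of the smooth `1`-forms on `Ω` for
the norm `(∫ |∇θ|² + |θ|²)^{1/2}`, realized as the closure of the pairs `(θ, ∇θ)` in `L²`. -/
def sobolevFormH1 [IsManifold (𝓡 n) ∞ M] (Ω : Set M) :
    Set ((∀ x : M, Covector n x) × (∀ x : M, TwoTensor n x)) :=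
  {p | ∃ θ : ℕ → ∀ x : M, Covector n x, (∀ k, SmoothFormOn (θ k) Ω) ∧
    L2Converges (volumeOn n Ω) (formSq n) θ p.1 ∧
    L2Converges (volumeOn n Ω) (tensorSq n) (fun k ↦ covDeriv (θ k)) p.2}

/-- The `j`-th Neumann eigenvalue `m_j` of the Laplacian on `Ω`, with Rayleigh quotient
`∫ |∇u|² / ∫ u²` on `H¹(Ω)`. -/
def laplaceEigenvalue (Ω : Set M) (j : ℕ) : EReal :=
  minMax (volumeOn n Ω) (sobolevH1 n Ω) (fun p ↦ formSq n p.2) (fun p ↦ funSq p.1) j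

/-- The `j`-th Neumann eigenvalue `μ_j` of the biharmonic operator on `Ω`, with Rayleigh quotient
`∫ (|D²u|² + Ric(∇u, ∇u)) / ∫ u²` on `H²(Ω)`. -/
def biharmonicEigenvalue (Ω : Set M) (j : ℕ) : EReal :=
  minMax (volumeOn n Ω) (sobolevH2 n Ω)
    (fun p x ↦ tensorSq n p.2.2 x + ricci x (sharp (p.2.1 x)) (sharp (p.2.1 x)))
    (fun p ↦ funSq p.1) j

/-- The `j`-th Neumann eigenvalue `η_j` of the rough Laplacian on `1`-forms of `Ω`, with Rayleigh
quotient `∫ |∇θ|² / ∫ |θ|²` on the `1`-forms of class `H¹(Ω)`. -/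
def roughLaplaceEigenvalue [IsManifold (𝓡 n) ∞ M] (Ω : Set M) (j : ℕ) : EReal :=
  minMax (volumeOn n Ω) (sobolevFormH1 n Ω) (fun p ↦ tensorSq n p.2) (fun p ↦ formSq n p.1) j

end Spaces

end NeumannBiharmonic

end

/-!
If `u` is of class `H²` then `du` is a `1`-form of class `H¹` with `∇du = D²u`, so
`η₁ ∫ |du|² ≤ ∫ |D²u|²`, while `Ric ≥ c g` gives `c ∫ |du|² ≤ ∫ Ric(∇u, ∇u)`. Adding the two
bounds the numerator of the Rayleigh quotient of `μ_j` at `u` below by `η₁ + c` times that of `m_j`.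
The denominators agree, and every trial space for `μ_j` is also one for `m_j`.
-/

namespace NeumannBiharmonic

lemma mul_iSup_le_of_forall_mul_le {ι : Type*} [Nonempty ι] {a b : EReal} {f : ι → EReal}
    (ha : 0 ≤ a) (hf : ∀ i, 0 ≤ f i) (h : ∀ i, a * f i ≤ b) : a * ⨆ i, f i ≤ b := by
  obtain rfl | ha_pos := ha.eq_or_lt
  · simpa using h
  obtain rfl | ha_top := eq_or_ne a ⊤
  · by_cases hpos : ∃ i, 0 < f i
    · obtain ⟨i, hi⟩ := hpos
      have hb : ⊤ ≤ b := EReal.top_mul_of_pos hi ▸ h i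
      exact le_top.trans hb
    · have hzero (i : ι) : f i = 0 := le_antisymm (not_lt.1 fun hi ↦ hpos ⟨i, hi⟩) (hf i)
      simpa [hzero] using h
  · rw [mul_comm, ← EReal.le_div_iff_mul_le ha_pos ha_top]
    refine iSup_le fun i ↦ ?_
    rw [EReal.le_div_iff_mul_le ha_pos ha_top, mul_comm]
    exact h i

section RayleighQuotient

variable {M V : Type*} [MeasurableSpace M] {μ : Measure M} {num den : V → M → ℝ}

/-- The Rayleigh quotient `(∫ num u dμ) / (∫ den u dμ)`, with value `0` where the denominator
vanishes. -/
noncomputable def rayleighQuotient (μ : Measure M) (num den : V → M → ℝ) (u : V) : ℝ :=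
  (∫ x, num u x ∂μ) / ∫ x, den u x ∂μ

lemma rayleighQuotient_nonneg {u : V} (hnum : 0 ≤ num u) (hden : 0 ≤ den u) :
    0 ≤ rayleighQuotient μ num den u :=
  div_nonneg (integral_nonneg hnum) (integral_nonneg hden)

end RayleighQuotient

section MinMax

variable {M V W : Type*} [MeasurableSpace M] [AddCommGroup V] [Module ℝ V] [AddCommGroup W]
  [Module ℝ W] {μ : Measure M} {D : Set V} {num den : V → M → ℝ} {D' : Set W}
  {num' den' : W → M → ℝ} {j : ℕ} {U : Submodule ℝ V}

/-- The `j`-dimensional spaces over which `minMax μ D num den j` is an infimum. -/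
structure IsTrialSpace (μ : Measure M) (D : Set V) (num den : V → M → ℝ) (j : ℕ)
    (U : Submodule ℝ V) : Prop where
  finrank_eq : Module.finrank ℝ U = j
  mem : ∀ u ∈ U, u ∈ D
  integrable : ∀ u ∈ U, Integrable (num u) μ
  den_pos : ∀ u ∈ U, u ≠ 0 → 0 < ∫ x, den u x ∂μ

lemma minMax_le_iSup (hU : IsTrialSpace μ D num den j U) :
    minMax μ D num den j
      ≤ ⨆ u : {u : V // u ∈ U ∧ u ≠ 0}, (rayleighQuotient μ num den u.1 : EReal) :=
  iInf_le_of_le ⟨U, hU.finrank_eq, fun u hu ↦ ⟨hU.mem u hu, hU.integrable u hu, hU.den_pos u hu⟩⟩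
    le_rfl

lemma le_minMax {b : EReal}
    (h : ∀ U, IsTrialSpace μ D num den j U →
      b ≤ ⨆ u : {u : V // u ∈ U ∧ u ≠ 0}, (rayleighQuotient μ num den u.1 : EReal)) :
    b ≤ minMax μ D num den j :=
  le_iInf fun ⟨U, hfin, hU⟩ ↦ h U
    ⟨hfin, fun u hu ↦ (hU u hu).1, fun u hu ↦ (hU u hu).2.1, fun u hu ↦ (hU u hu).2.2⟩

lemma rayleighQuotient_smul {u : V} {c : ℝ} (hc : c ≠ 0) (hnum : num (c • u) = c ^ 2 • num u)
    (hden : den (c • u) = c ^ 2 • den u) :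
    rayleighQuotient μ num den (c • u) = rayleighQuotient μ num den u := by
  simp only [rayleighQuotient, hnum, hden, Pi.smul_apply, smul_eq_mul, integral_const_mul]
  exact mul_div_mul_left _ _ (pow_ne_zero 2 hc)

lemma IsTrialSpace.nonempty_ne_zero (hU : IsTrialSpace μ D num den j U) (hj : 1 ≤ j) :
    Nonempty {u : V // u ∈ U ∧ u ≠ 0} := by
  have : Nontrivial U :=
    Module.nontrivial_of_finrank_pos (R := ℝ) (hU.finrank_eq.symm ▸ Nat.zero_lt_of_lt hj)
  obtain ⟨u, hu⟩ := exists_ne (0 : U)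
  exact ⟨u, u.2, by simpa using hu⟩

lemma minMax_nonneg (hnum : ∀ u, 0 ≤ num u) (hden : ∀ u, 0 ≤ den u) (hj : 1 ≤ j) :
    0 ≤ minMax μ D num den j :=
  le_minMax fun _ hU ↦
    have ⟨u⟩ := hU.nonempty_ne_zero hj
    le_iSup_of_le u (EReal.coe_nonneg.2 (rayleighQuotient_nonneg (hnum _) (hden _)))

lemma isTrialSpace_span_singleton {u : V} (hD : ∀ c : ℝ, c • u ∈ D)
    (hnum : ∀ c : ℝ, num (c • u) = c ^ 2 • num u) (hden : ∀ c : ℝ, den (c • u) = c ^ 2 • den u)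
    (hint : Integrable (num u) μ) (hpos : 0 < ∫ x, den u x ∂μ) :
    IsTrialSpace μ D num den 1 (Submodule.span ℝ {u}) := by
  have hu : u ≠ 0 := by
    rintro rfl
    have hden_zero : den 0 = 0 := by simpa using hden 0
    simp [hden_zero] at hpos
  refine ⟨finrank_span_singleton hu, ?_, ?_, ?_⟩ <;> intro v hv <;>
    obtain ⟨c, rfl⟩ := Submodule.mem_span_singleton.1 hv
  · exact hD c
  · exact hnum c ▸ hint.smul (c ^ 2)
  · intro hcu
    have hc : c ≠ 0 := left_ne_zero_of_smul hcu
    simp only [hden, Pi.smul_apply, smul_eq_mul, integral_const_mul]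
    positivity

lemma minMax_one_le_rayleighQuotient {u : V} (hD : ∀ c : ℝ, c • u ∈ D)
    (hnum : ∀ c : ℝ, num (c • u) = c ^ 2 • num u) (hden : ∀ c : ℝ, den (c • u) = c ^ 2 • den u)
    (hint : Integrable (num u) μ) (hpos : 0 < ∫ x, den u x ∂μ) :
    minMax μ D num den 1 ≤ rayleighQuotient μ num den u := by
  refine (minMax_le_iSup (isTrialSpace_span_singleton hD hnum hden hint hpos)).trans
    (iSup_le fun ⟨v, hv, hv0⟩ ↦ ?_)
  obtain ⟨c, rfl⟩ := Submodule.mem_span_singleton.1 hv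
  rw [rayleighQuotient_smul (left_ne_zero_of_smul hv0) (hnum c) (hden c)]

lemma minMax_one_mul_integral_le {u : V} (hD : ∀ c : ℝ, c • u ∈ D)
    (hnum : ∀ c : ℝ, num (c • u) = c ^ 2 • num u) (hden : ∀ c : ℝ, den (c • u) = c ^ 2 • den u)
    (hint : Integrable (num u) μ) (hnum_nonneg : 0 ≤ num u) (hden_nonneg : 0 ≤ den u) :
    minMax μ D num den 1 * ((∫ x, den u x ∂μ : ℝ) : EReal) ≤ ((∫ x, num u x ∂μ : ℝ) : EReal) := by
  have hden_integral : 0 ≤ ∫ x, den u x ∂μ := integral_nonneg hden_nonneg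
  obtain hzero | hpos := hden_integral.eq_or_lt
  · rw [← hzero, EReal.coe_zero, mul_zero]
    exact EReal.coe_nonneg.2 (integral_nonneg hnum_nonneg)
  · rw [← EReal.le_div_iff_mul_le (EReal.coe_pos.2 hpos) (EReal.coe_ne_top _), ← EReal.coe_div]
    exact minMax_one_le_rayleighQuotient hD hnum hden hint hpos

lemma IsTrialSpace.map (hU : IsTrialSpace μ D num den j U) (L : V →ₗ[ℝ] W)
    (hD : ∀ u ∈ D, L u ∈ D') (hint : ∀ u ∈ D, Integrable (num' (L u)) μ)
    (hden : ∀ u, den' (L u) = den u) (hden_zero : den 0 = 0) :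
    IsTrialSpace μ D' num' den' j (U.map L) := by
  have hker (u : V) (hu : u ∈ U) (hLu : L u = 0) : u = 0 := by
    by_contra hne
    have hpos := hU.den_pos u hu hne
    have hden_u : den u = 0 := by rw [← hden, hLu, ← map_zero L, hden, hden_zero]
    simp [hden_u] at hpos
  have hinj : Function.Injective (L.domRestrict U) :=
    (injective_iff_map_eq_zero _).2 fun u hu ↦ Subtype.ext (hker u u.2 hu)
  refine ⟨?_, ?_, ?_, ?_⟩
  · rw [← LinearMap.range_domRestrict, LinearMap.finrank_range_of_inj hinj, hU.finrank_eq]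
  · rintro _ ⟨u, hu, rfl⟩
    exact hD u (hU.mem u hu)
  · rintro _ ⟨u, hu, rfl⟩
    exact hint u (hU.mem u hu)
  · rintro _ ⟨u, hu, rfl⟩ hLu
    rw [hden]
    exact hU.den_pos u hu fun h ↦ hLu (h ▸ map_zero L)

lemma mul_minMax_le_minMax_of_linearMap (L : V →ₗ[ℝ] W) {a : EReal} (ha : 0 ≤ a) (hj : 1 ≤ j)
    (hD : ∀ u ∈ D, L u ∈ D') (hint : ∀ u ∈ D, Integrable (num' (L u)) μ)
    (hden : ∀ u, den' (L u) = den u) (hden_zero : den 0 = 0)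
    (hnum_nonneg : ∀ u, 0 ≤ num' (L u)) (hden_nonneg : ∀ u, 0 ≤ den u)
    (hle : ∀ u ∈ D, Integrable (num u) μ →
      a * ((∫ x, num' (L u) x ∂μ : ℝ) : EReal) ≤ ((∫ x, num u x ∂μ : ℝ) : EReal)) :
    a * minMax μ D' num' den' j ≤ minMax μ D num den j := by
  refine le_minMax fun U hU ↦ ?_
  have := hU.nonempty_ne_zero hj
  have hminMax : minMax μ D' num' den' j
      ≤ ⨆ u : {u : V // u ∈ U ∧ u ≠ 0}, (rayleighQuotient μ num' den' (L u.1) : EReal) := by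
    refine (minMax_le_iSup (hU.map L hD hint hden hden_zero)).trans (iSup_le ?_)
    rintro ⟨_, ⟨u, hu, rfl⟩, hLu⟩
    exact le_iSup_of_le ⟨u, hu, fun h ↦ hLu (h ▸ map_zero L)⟩ le_rfl
  refine (mul_le_mul_of_nonneg_left hminMax ha).trans (mul_iSup_le_of_forall_mul_le ha
    (fun u ↦ EReal.coe_nonneg.2 (rayleighQuotient_nonneg (hnum_nonneg _) ?_)) fun u ↦ ?_)
  · exact hden u.1 ▸ hden_nonneg u.1
  · refine le_iSup_of_le u ?_
    rw [rayleighQuotient, rayleighQuotient, hden, EReal.coe_div, EReal.coe_div, EReal.mul_div]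
    exact EReal.div_le_div_right_of_nonneg
      (EReal.coe_nonneg.2 (integral_nonneg (hden_nonneg u.1)))
      (hle u.1 (hU.mem _ u.2.1) (hU.integrable _ u.2.1))

end MinMax

lemma L2Converges.const_smul {M S : Type*} [MeasurableSpace M] [AddCommGroup S] [Module ℝ S]
    {μ : Measure M} {nsq : S → M → ℝ} {s : ℕ → S} {t : S} (h : L2Converges μ nsq s t) (c : ℝ)
    (hnsq : ∀ s, nsq (c • s) = c ^ 2 • nsq s) :
    L2Converges μ nsq (fun k ↦ c • s k) (c • t) := by
  obtain ⟨hs, ht, hst, hlim⟩ := h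
  simp only [L2Converges, ← smul_sub, hnsq, Pi.smul_apply, integral_smul]
  exact ⟨fun k ↦ (hs k).smul _, ht.smul _, fun k ↦ (hst k).smul _,
    by simpa using hlim.const_smul (c ^ 2)⟩

section Forms

variable {n : ℕ} {M : Type*} [MetricSpace M] [ChartedSpace (Model n) M]

lemma partialDeriv_const_smul (i : Fin n) (c : ℝ) (F : Model n → ℝ) (y : Model n) :
    partialDeriv i (c • F) y = c * partialDeriv i F y := by
  simp [partialDeriv, fderiv_const_smul_field]

lemma formCoeff_const_smul (c : ℝ) (θ : ∀ x : M, Covector n x) (p : M) (j : Fin n) :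
    formCoeff (c • θ) p j = c • formCoeff θ p j := rfl

lemma SmoothFormOn.const_smul [IsManifold (𝓡 n) ∞ M] {θ : ∀ x : M, Covector n x} {Ω : Set M}
    (hθ : SmoothFormOn θ Ω) (c : ℝ) : SmoothFormOn (c • θ) Ω :=
  ContMDiffOn.const_smul_section hθ

lemma smoothFormOn_differential [IsManifold (𝓡 n) ∞ M] {f : M → ℝ} {Ω : Set M}
    (hΩ : IsOpen Ω) (hf : ContMDiffOn (𝓡 n) 𝓘(ℝ, ℝ) ∞ f Ω) :
    SmoothFormOn (n := n) (differential f) Ω := by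
  intro x hx
  apply ContMDiffAt.contMDiffWithinAt
  refine (contMDiffAt_hom_bundle _).2 ⟨contMDiffAt_id, ?_⟩
  convert (hf.contMDiffAt (hΩ.mem_nhds hx)).mfderiv_const (m := ∞) (by simp) using 1
  ext1 y
  have htriv : (trivializationAt ℝ (Trivial M ℝ) x).continuousLinearMapAt ℝ y =
      ContinuousLinearMap.id ℝ ℝ := Trivial.continuousLinearMapAt_trivialization ℝ M ℝ y
  simp only [inTangentCoordinates, ContinuousLinearMap.inCoordinates]
  rw [htriv, TangentBundle.continuousLinearMapAt_model_space]
  rfl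

variable [RiemannianBundle (fun x : M ↦ TangentSpace (𝓡 n) x)]

lemma covDeriv_const_smul (c : ℝ) (θ : ∀ x : M, Covector n x) :
    covDeriv (c • θ) = c • covDeriv θ := by
  ext1 x
  simp only [covDeriv, formCoeff_const_smul, partialDeriv_const_smul, Pi.smul_apply, smul_eq_mul,
    Finset.smul_sum, smul_smul, mul_sub, Finset.mul_sum, mul_left_comm c]

lemma formSq_nonneg (θ : ∀ x : M, Covector n x) : 0 ≤ formSq n θ :=
  fun x ↦ show 0 ≤ covectorNormSq (θ x) from Finset.sum_nonneg fun _ _ ↦ sq_nonneg _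

lemma tensorSq_nonneg (A : ∀ x : M, TwoTensor n x) : 0 ≤ tensorSq n A :=
  fun x ↦ show 0 ≤ tensorNormSq (A x) from
    Finset.sum_nonneg fun _ _ ↦ Finset.sum_nonneg fun _ _ ↦ sq_nonneg _

lemma formSq_const_smul (c : ℝ) (θ : ∀ x : M, Covector n x) :
    formSq n (c • θ) = c ^ 2 • formSq n θ := by
  ext x
  simp [formSq, covectorNormSq, Finset.mul_sum, mul_pow]

lemma tensorSq_const_smul (c : ℝ) (A : ∀ x : M, TwoTensor n x) :
    tensorSq n (c • A) = c ^ 2 • tensorSq n A := by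
  ext x
  simp [tensorSq, tensorNormSq, Finset.mul_sum, mul_pow]

lemma inner_sharp_self {x : M} (α : Covector n x) :
    inner ℝ (sharp α) (sharp α) = covectorNormSq α := by
  rw [sharp, (stdOrthonormalBasis ℝ (TangentSpace (𝓡 n) x)).orthonormal.inner_sum, covectorNormSq]
  simp [sq]

end Forms

section Sobolev

variable {n : ℕ} {M : Type*} [MetricSpace M] [ChartedSpace (Model n) M]
  [RiemannianBundle (fun x : M ↦ TangentSpace (𝓡 n) x)] [MeasurableSpace M] {Ω : Set M}
  {u : (M → ℝ) × (∀ x : M, Covector n x) × (∀ x : M, TwoTensor n x)}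

lemma integrable_formSq_of_mem_sobolevH2 (hu : u ∈ sobolevH2 n Ω) :
    Integrable (formSq n u.2.1) (volumeOn n Ω) :=
  have ⟨_, _, _, hdu, _⟩ := hu
  hdu.2.1

lemma integrable_tensorSq_of_mem_sobolevH2 (hu : u ∈ sobolevH2 n Ω) :
    Integrable (tensorSq n u.2.2) (volumeOn n Ω) :=
  have ⟨_, _, _, _, hD2u⟩ := hu
  hD2u.2.1

lemma mem_sobolevH1_of_mem_sobolevH2 (hu : u ∈ sobolevH2 n Ω) : (u.1, u.2.1) ∈ sobolevH1 n Ω :=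
  have ⟨f, hf, hf_lim, hdf_lim, _⟩ := hu
  ⟨f, hf, hf_lim, hdf_lim⟩

lemma integral_add_mul_integral_le_of_le_ricci [OpensMeasurableSpace M] (hΩ : IsOpen Ω) {c : ℝ}
    (hRic : ∀ x ∈ Ω, ∀ v : TangentSpace (𝓡 n) x, c * inner ℝ v v ≤ ricci x v v)
    (hu : u ∈ sobolevH2 n Ω)
    (hint : Integrable (fun x ↦ tensorSq n u.2.2 x + ricci x (sharp (u.2.1 x)) (sharp (u.2.1 x)))
      (volumeOn n Ω)) :
    ∫ x, tensorSq n u.2.2 x ∂volumeOn n Ω + c * ∫ x, formSq n u.2.1 x ∂volumeOn n Ω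
      ≤ ∫ x, tensorSq n u.2.2 x + ricci x (sharp (u.2.1 x)) (sharp (u.2.1 x)) ∂volumeOn n Ω := by
  have hdu := (integrable_formSq_of_mem_sobolevH2 hu).const_mul c
  have hD2u := integrable_tensorSq_of_mem_sobolevH2 hu
  rw [← integral_const_mul, ← integral_add hD2u hdu]
  refine integral_mono_ae (hD2u.add hdu) hint ?_
  filter_upwards [ae_restrict_mem hΩ.measurableSet] with x hx
  have hRic_du := hRic x hx (sharp (u.2.1 x))
  rw [inner_sharp_self] at hRic_du
  exact add_le_add le_rfl hRic_du

variable [IsManifold (𝓡 n) ∞ M]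

lemma differential_mem_sobolevFormH1_of_mem_sobolevH2 (hΩ : IsOpen Ω) (hu : u ∈ sobolevH2 n Ω) :
    u.2 ∈ sobolevFormH1 n Ω :=
  have ⟨f, hf, _, hdf_lim, hD2f_lim⟩ := hu
  ⟨fun k ↦ differential (f k), fun k ↦ smoothFormOn_differential hΩ (hf k), hdf_lim, hD2f_lim⟩

lemma const_smul_mem_sobolevFormH1 {p : (∀ x : M, Covector n x) × (∀ x : M, TwoTensor n x)}
    (hp : p ∈ sobolevFormH1 n Ω) (c : ℝ) : c • p ∈ sobolevFormH1 n Ω := by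
  obtain ⟨θ, hθ, hθ_lim, hcov_lim⟩ := hp
  refine ⟨fun k ↦ c • θ k, fun k ↦ (hθ k).const_smul c,
    hθ_lim.const_smul c (formSq_const_smul c), ?_⟩
  simp only [covDeriv_const_smul]
  exact hcov_lim.const_smul c (tensorSq_const_smul c)

lemma roughLaplaceEigenvalue_nonneg (Ω : Set M) {j : ℕ} (hj : 1 ≤ j) :
    0 ≤ roughLaplaceEigenvalue n Ω j :=
  minMax_nonneg (fun p ↦ tensorSq_nonneg p.2) (fun p ↦ formSq_nonneg p.1) hj

lemma roughLaplaceEigenvalue_one_mul_integral_le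
    {p : (∀ x : M, Covector n x) × (∀ x : M, TwoTensor n x)} (hp : p ∈ sobolevFormH1 n Ω) :
    roughLaplaceEigenvalue n Ω 1 * ((∫ x, formSq n p.1 x ∂volumeOn n Ω : ℝ) : EReal)
      ≤ ((∫ x, tensorSq n p.2 x ∂volumeOn n Ω : ℝ) : EReal) :=
  have hint : Integrable (tensorSq n p.2) (volumeOn n Ω) :=
    have ⟨_, _, _, hcov_lim⟩ := hp
    hcov_lim.2.1
  minMax_one_mul_integral_le (const_smul_mem_sobolevFormH1 hp)
    (fun c ↦ tensorSq_const_smul c p.2) (fun c ↦ formSq_const_smul c p.1) hint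
    (tensorSq_nonneg p.2) (formSq_nonneg p.1)

lemma roughLaplaceEigenvalue_add_mul_integral_le [OpensMeasurableSpace M] (hΩ : IsOpen Ω) {c : ℝ}
    (hRic : ∀ x ∈ Ω, ∀ v : TangentSpace (𝓡 n) x, c * inner ℝ v v ≤ ricci x v v)
    (hu : u ∈ sobolevH2 n Ω)
    (hint : Integrable (fun x ↦ tensorSq n u.2.2 x + ricci x (sharp (u.2.1 x)) (sharp (u.2.1 x)))
      (volumeOn n Ω)) :
    (roughLaplaceEigenvalue n Ω 1 + c) * ((∫ x, formSq n u.2.1 x ∂volumeOn n Ω : ℝ) : EReal)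
      ≤ ((∫ x, tensorSq n u.2.2 x + ricci x (sharp (u.2.1 x)) (sharp (u.2.1 x))
          ∂volumeOn n Ω : ℝ) : EReal) := by
  set B := ∫ x, formSq n u.2.1 x ∂volumeOn n Ω
  have hB : 0 ≤ B := integral_nonneg (formSq_nonneg u.2.1)
  calc (roughLaplaceEigenvalue n Ω 1 + c) * (B : EReal)
      = roughLaplaceEigenvalue n Ω 1 * B + c * B :=
        EReal.right_distrib_of_nonneg_of_ne_top (EReal.coe_nonneg.2 hB) (EReal.coe_ne_top B) _ _
    _ ≤ ((∫ x, tensorSq n u.2.2 x ∂volumeOn n Ω : ℝ) : EReal) + c * B := by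
        gcongr
        exact roughLaplaceEigenvalue_one_mul_integral_le
          (differential_mem_sobolevFormH1_of_mem_sobolevH2 hΩ hu)
    _ ≤ _ := by
        exact_mod_cast integral_add_mul_integral_le_of_le_ricci hΩ hRic hu hint

end Sobolev

end NeumannBiharmonic

open NeumannBiharmonic in
theorem mainTheorem9_general (n : ℕ) {M : Type*} [MetricSpace M]
    [ChartedSpace (EuclideanSpace ℝ (Fin n)) M] [IsManifold (𝓡 n) ∞ M]
    [RiemannianBundle (fun x : M ↦ TangentSpace (𝓡 n) x)]
    [IsContMDiffRiemannianBundle (𝓡 n) ∞ (EuclideanSpace ℝ (Fin n))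
      (fun x : M ↦ TangentSpace (𝓡 n) x)]
    [MeasurableSpace M] [BorelSpace M] (Ω : Set M) (hΩ : IsOpen Ω) (c : ℝ)
    (hRic : ∀ x ∈ Ω, ∀ v : TangentSpace (𝓡 n) x, c * inner ℝ v v ≤ ricci x v v)
    (hc : 0 ≤ roughLaplaceEigenvalue n Ω 1 + c) (j : ℕ) (hj : 1 ≤ j) :
    (roughLaplaceEigenvalue n Ω 1 + c) * laplaceEigenvalue n Ω j ≤ biharmonicEigenvalue n Ω j := by
  let forgetHessian := LinearMap.prodMap (LinearMap.id : (M → ℝ) →ₗ[ℝ] M → ℝ)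
    (LinearMap.fst ℝ (∀ x : M, Covector n x) (∀ x : M, TwoTensor n x))
  have hfunSq_zero : funSq (0 : M → ℝ) = 0 := by
    ext x
    simp [funSq]
  rw [laplaceEigenvalue, biharmonicEigenvalue]
  exact mul_minMax_le_minMax_of_linearMap forgetHessian hc hj
    (fun _ ↦ mem_sobolevH1_of_mem_sobolevH2) (fun _ ↦ integrable_formSq_of_mem_sobolevH2)
    (fun _ ↦ rfl) hfunSq_zero (fun u ↦ formSq_nonneg u.2.1) (fun u x ↦ sq_nonneg (u.1 x))
    (fun _ ↦ roughLaplaceEigenvalue_add_mul_integral_le hΩ hRic)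

theorem mainTheorem9 (n : ℕ) (hn : 2 ≤ n)
    {M : Type*} [MetricSpace M] [SecondCountableTopology M]
    [ChartedSpace (EuclideanSpace ℝ (Fin n)) M] [IsManifold (𝓡 n) ∞ M]
    [RiemannianBundle (fun x : M ↦ TangentSpace (𝓡 n) x)]
    [IsContMDiffRiemannianBundle (𝓡 n) ∞ (EuclideanSpace ℝ (Fin n))
      (fun x : M ↦ TangentSpace (𝓡 n) x)]
    [IsRiemannianManifold (𝓡 n) M] [CompleteSpace M]
    [MeasurableSpace M] [BorelSpace M]
    (K : ℝ) (hK : 0 < K)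
    (hRic : ∀ (x : M) (v : TangentSpace (𝓡 n) x),
      ((n : ℝ) - 1) * K * inner ℝ v v ≤ NeumannBiharmonic.ricci x v v)
    (Ω : Set M) (hΩ_open : IsOpen Ω) (hΩ_conn : IsConnected Ω)
    (hΩ_bdd : Bornology.IsBounded Ω) (hΩ_C1 : NeumannBiharmonic.HasC1Boundary n Ω)
    (j : ℕ) (hj : 1 ≤ j) :
    (NeumannBiharmonic.roughLaplaceEigenvalue n Ω 1 + ((((n : ℝ) - 1) * K : ℝ) : EReal))
        * NeumannBiharmonic.laplaceEigenvalue n Ω j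
      ≤ NeumannBiharmonic.biharmonicEigenvalue n Ω j := by
  have hc : 0 ≤ ((n : ℝ) - 1) * K :=
    mul_nonneg (sub_nonneg.2 (Nat.one_le_cast.2 (Nat.one_le_of_lt hn))) hK.le
  exact mainTheorem9_general n Ω hΩ_open _ (fun x _ ↦ hRic x) (add_nonneg
    (NeumannBiharmonic.roughLaplaceEigenvalue_nonneg Ω le_rfl) (EReal.coe_nonneg.2 hc)) j hj
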